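/- Let $0\le m\le n$ be integers. Let $$\mathrm{Gr}_{m,n}=\{P\in\mathbb C^{n\times n}\mid P^{H}=P,\ P^2=P,\ \operatorname{tr}P=m\}$$ be the complex Grassmannian, realised as the manifold of rank $m$ Hermitian projections, with the Riemannian metric $g_P(H_1,H_2)=\operatorname{tr}(H_1H_2)$ on its tangent spaces. Let $\operatorname{dist}(P,Q)$ be the geodesic distance, i.e. the infimum of the lengths $\int_0^1\sqrt{g_{\gamma(t)}(\dot\gamma(t),\dot\gamma(t))}\,dt$ of the $C^1$ curves $\gamma\colon[0,1]\to\mathrm{Gr}_{m,n}$ with $\gamma(0)=P$, $\gamma(1)=Q$. Let $E=\begin{bmatrix}I_m&0\\0&0\end{bmatrix}$ be the standard projector, let $\|\cdot\|$ be the Frobenius norm, and write $[A,B]=AB-BA$. For $Z\in\mathbb C^{(n-m)\times m}$ put $$\mathcal Z=\begin{bmatrix}0&-Z^{H}\\Z&0\end{bmatrix}.$$ Then for every sufficiently small open ball $B_0\subset\mathbb C^{(n-m)\times m}$ (in the Frobenius norm) around $0$ there is an open neighbourhood $U$ of $E$ in $\mathrm{Gr}_{m,n}$ such that $Z\mapsto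 e^{\mathcal Z}Ee^{-\mathcal Z}$ is a bijection from $B_0$ onto $U$. Thus each $P\in U$ can be written as $P=e^{\mathcal Z(P)}Ee^{-\mathcal Z(P)}$ with a unique $Z=Z(P)\in B_0$ and $\mathcal Z(P)=\begin{bmatrix}0&-Z(P)^{H}\\Z(P)&0\end{bmatrix}$. For each $P\in U$, the geodesic distance from $E$ to $P$ is $$\operatorname{dist}(E,P)=\|[\mathcal Z(P),E]\|.$$ -/

import Mathlib

open Set Matrix

-- Matrices carry the Frobenius norm (with its usual topology) throughout.
attribute [local instance] Matrix.frobeniusNormedAddCommGroup Matrix.frobeniusNormedSpace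

noncomputable section

namespace Grassmann

/-- The complex Grassmannian of `m`-dimensional subspaces, realised as the set of Hermitian
projection matrices of trace `m`. The size is the cardinality of the index type `ι`. -/
def Gr (m : ℕ) (ι : Type*) [Fintype ι] : Set (Matrix ι ι ℂ) :=
  {P | Pᴴ = P ∧ P * P = P ∧ P.trace = (m : ℂ)}

/-- The Riemannian metric of the Grassmannian, `g_P(H₁, H₂) = tr (H₁ H₂)`. It is the restriction
to tangent vectors (which are Hermitian) of the Frobenius inner product of Hermitian matrices,
for which this trace is real. -/
def metric {ι : Type*} [Fintype ι] (H₁ H₂ : Matrix ι ι ℂ) : ℝ :=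
  (H₁ * H₂).trace.re

/-- On a Hermitian matrix the metric is the square of the Frobenius norm. -/
theorem metric_self {ι : Type*} [Fintype ι] {H : Matrix ι ι ℂ} (hH : Hᴴ = H) :
    metric H H = ‖H‖ ^ 2 := by
  have h : ∀ i j, H i j * H j i = ((‖H i j‖ ^ 2 : ℝ) : ℂ) := by
    intro i j
    have h1 : H j i = star (H i j) := by
      conv_lhs => rw [← hH]
      rfl
    rw [h1]
    simpa using Complex.mul_conj' (H i j)
  rw [Matrix.frobenius_norm_def, ← Real.rpow_natCast, ← Real.rpow_mul (by positivity)]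
  simp only [metric, Matrix.trace, Matrix.diag_apply, Matrix.mul_apply, h]
  norm_num
  norm_cast

/-- `γ`, restricted to `[0, 1]`, is a `C¹` curve from `P` to `Q` inside the set `M` of matrices. -/
structure IsCurve {ι : Type*} [Fintype ι] (M : Set (Matrix ι ι ℂ)) (P Q : Matrix ι ι ℂ)
    (γ : ℝ → Matrix ι ι ℂ) : Prop where
  contDiffOn : ContDiffOn ℝ 1 γ (Icc 0 1)
  mapsTo : MapsTo γ (Icc 0 1) M
  source : γ 0 = P
  target : γ 1 = Q

/-- The Riemannian length `∫₀¹ √(g(γ', γ')) dt` of a curve. -/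
def length {ι : Type*} [Fintype ι] (γ : ℝ → Matrix ι ι ℂ) : ℝ :=
  ∫ t in (0 : ℝ)..1,
    √(metric (derivWithin γ (Icc 0 1) t) (derivWithin γ (Icc 0 1) t))

/-- The geodesic (Riemannian) distance on `Gr m ι`: the infimum of the lengths of the curves in
`Gr m ι` that join the two points, with the value `⊤` if there is no such curve. -/
def geodesicDist (m : ℕ) {ι : Type*} [Fintype ι] (P Q : Matrix ι ι ℂ) : ENNReal :=
  ⨅ (γ : ℝ → Matrix ι ι ℂ) (_ : IsCurve (Gr m ι) P Q γ), ENNReal.ofReal (length γ)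

/-- The standard projector, with blocks `I, 0, 0, 0`. -/
def stdProj (m k : ℕ) : Matrix (Fin m ⊕ Fin k) (Fin m ⊕ Fin k) ℂ :=
  fromBlocks 1 0 0 0

/-- The block-antidiagonal matrix with blocks `0, -Zᴴ, Z, 0`. -/
def blockZ {m k : ℕ} (Z : Matrix (Fin k) (Fin m) ℂ) :
    Matrix (Fin m ⊕ Fin k) (Fin m ⊕ Fin k) ℂ :=
  fromBlocks 0 (-Zᴴ) Z 0

/-- The matrix `e^{𝒵} E e^{-𝒵}`, where `𝒵 = blockZ Z` and `E` is the standard projector. -/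
def rotated {m k : ℕ} (Z : Matrix (Fin k) (Fin m) ℂ) :
    Matrix (Fin m ⊕ Fin k) (Fin m ⊕ Fin k) ℂ :=
  NormedSpace.exp (blockZ Z) * stdProj m k * NormedSpace.exp (-blockZ Z)

end Grassmann

end

/-! ### Cauchy–Schwarz and the first variation of the matrix exponential. -/

section FrobeniusAlgebra

attribute [local instance] Matrix.frobeniusNormedRing Matrix.frobeniusNormedAlgebra

open Filter Topology

namespace Grassmann

section General

variable {ι : Type*} [Fintype ι]

/-! Upper bound: `t ↦ rotated (t • Z)` runs from `E` to `rotated Z`, and its velocity is a unitary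
conjugate of `[𝒵, E]`, so its speed is constantly `‖[𝒵, E]‖` (`geodesicDist_le`).

Lower bound: this is the Gauss lemma. Write a curve as `γ = rotated ∘ w`, put `X = blockZ (w t)` and
`ρ = ‖[X, E]‖`, so that `ρ² = -tr X² = 2‖w‖²`. Pairing `γ'` with the radial vector `e^X [X, E]
e^{-X}`, of norm `ρ`, gives half the derivative of `ρ²`; the point is that `tr (X e^{-X} dexp_X H) =
tr (X H)` (`trace_mul_exp_neg_mul_fderiv_exp`). Cauchy–Schwarz then yields `ρ' ≤ ‖γ'‖` where `ρ >
0`, and integration bounds the length below by the radius reached. A curve that leaves the chart is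
cut at its first exit from the image of the ball of radius `‖Z‖`, where the full radius has been
attained.

Chart (`exists_log`): the lower left block of `rotated Z` has derivative the identity at `0`, so the
inverse function theorem supplies a logarithm. Near `E`, a projection is determined by that block,
which makes images of small balls relatively open in the Grassmannian. -/

theorem metric_comm (A B : Matrix ι ι ℂ) : metric A B = metric B A := by
  rw [metric, metric, trace_mul_comm]

/-- Cauchy–Schwarz for the Grassmannian metric on Hermitian matrices. -/
theorem metric_le_norm_mul_norm {A B : Matrix ι ι ℂ} (hA : Aᴴ = A) (hB : Bᴴ = B) :
    metric A B ≤ ‖A‖ * ‖B‖ := by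
  rcases eq_or_ne A 0 with rfl | hA0
  · simp [metric]
  rcases eq_or_ne B 0 with rfl | hB0
  · simp [metric]
  -- The inequality comes from expanding the nonnegative square of `‖B‖A - ‖A‖B`.
  have hC : (‖B‖ • A - ‖A‖ • B)ᴴ = ‖B‖ • A - ‖A‖ • B := by
    simp [conjTranspose_sub, conjTranspose_smul, hA, hB]
  have h1 := metric_self hC
  have h2 : metric (‖B‖ • A - ‖A‖ • B) (‖B‖ • A - ‖A‖ • B) =
      ‖B‖ ^ 2 * metric A A - 2 * (‖A‖ * ‖B‖) * metric A B + ‖A‖ ^ 2 * metric B B := by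
    have h3 := metric_comm A B
    simp only [metric, sub_mul, mul_sub, trace_sub, Complex.sub_re, smul_mul_assoc,
      mul_smul_comm, trace_smul, Complex.smul_re, smul_eq_mul] at h3 ⊢
    rw [← h3]
    ring
  rw [h2, metric_self hA, metric_self hB] at h1
  have hpos : 0 < ‖A‖ * ‖B‖ := mul_pos (norm_pos_iff.2 hA0) (norm_pos_iff.2 hB0)
  have h4 := sq_nonneg ‖‖B‖ • A - ‖A‖ • B‖
  nlinarith

variable [DecidableEq ι]

theorem contDiff_exp {n : WithTop ℕ∞} :
    ContDiff ℝ n (NormedSpace.exp : Matrix ι ι ℂ → Matrix ι ι ℂ) :=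
  contDiff_iff_contDiffAt.2 fun X => (NormedSpace.exp_analytic (𝕂 := ℝ) X).contDiffAt

theorem exp_mul_exp_neg (X : Matrix ι ι ℂ) :
    NormedSpace.exp X * NormedSpace.exp (-X) = 1 := by
  rw [← Matrix.exp_add_of_commute _ _ (Commute.neg_right (Commute.refl X)), add_neg_cancel,
    NormedSpace.exp_zero]

theorem exp_neg_mul_exp (X : Matrix ι ι ℂ) :
    NormedSpace.exp (-X) * NormedSpace.exp X = 1 := by
  simpa using exp_mul_exp_neg (-X)

theorem conjTranspose_exp {X : Matrix ι ι ℂ} (hX : Xᴴ = -X) :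
    (NormedSpace.exp X)ᴴ = NormedSpace.exp (-X) := by
  rw [← hX]
  exact (Matrix.exp_conjTranspose X).symm

/-- If `C` commutes with `X`, then `tr (C e^{-X} D)` is invariant under halving `X`, where `D` is
the derivative of the exponential at `X` in the direction `H`. -/
theorem trace_mul_exp_neg_mul_fderiv_exp_half {X C : Matrix ι ι ℂ} (hC : Commute C X)
    (H : Matrix ι ι ℂ) :
    trace (C * NormedSpace.exp (-X) * fderiv ℝ NormedSpace.exp X H) =
      trace (C * NormedSpace.exp (-((1 / 2 : ℝ) • X)) *
        fderiv ℝ NormedSpace.exp ((1 / 2 : ℝ) • X) H) := by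
  set Y : Matrix ι ι ℂ := (1 / 2 : ℝ) • X with hY
  have hXY : X = Y + Y := by rw [hY, ← add_smul]; norm_num
  have hCY : Commute C Y := hC.smul_right _
  have hsq : ∀ W : Matrix ι ι ℂ, NormedSpace.exp W =
      NormedSpace.exp ((1 / 2 : ℝ) • W) * NormedSpace.exp ((1 / 2 : ℝ) • W) := by
    intro W
    rw [← Matrix.exp_add_of_commute _ _ (Commute.refl _), ← add_smul]
    norm_num
  have hd : ∀ W : Matrix ι ι ℂ, HasFDerivAt (𝕜 := ℝ) NormedSpace.exp (fderiv ℝ NormedSpace.exp W) W :=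
    fun W => ((contDiff_exp (n := 1)).differentiable (by norm_num) W).hasFDerivAt
  have hhalf : HasFDerivAt (𝕜 := ℝ)
      (fun W : Matrix ι ι ℂ => NormedSpace.exp ((1 / 2 : ℝ) • W))
      ((fderiv ℝ NormedSpace.exp Y).comp
        ((1 / 2 : ℝ) • ContinuousLinearMap.id ℝ (Matrix ι ι ℂ))) X :=
    HasFDerivAt.comp X (hd Y) ((hasFDerivAt_id X).const_smul (1 / 2 : ℝ))
  have hprod := hhalf.mul' hhalf
  have heq : fderiv ℝ NormedSpace.exp X = _ :=
    (hprod.congr_of_eventuallyEq (Eventually.of_forall hsq)).fderiv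
  -- Product rule for `e^X = e^{X/2} e^{X/2}`. Under the trace both terms give the same value, since
  -- `C` commutes with `e^{-Y}`.
  have hD : fderiv ℝ NormedSpace.exp X H = (1 / 2 : ℝ) •
      (NormedSpace.exp Y * fderiv ℝ NormedSpace.exp Y H +
        fderiv ℝ NormedSpace.exp Y H * NormedSpace.exp Y) := by
    rw [heq]
    change NormedSpace.exp Y * fderiv ℝ NormedSpace.exp Y ((1 / 2 : ℝ) • H) +
      fderiv ℝ NormedSpace.exp Y ((1 / 2 : ℝ) • H) * NormedSpace.exp Y = _
    rw [map_smul, mul_smul_comm, smul_mul_assoc, smul_add]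
  set D := fderiv ℝ NormedSpace.exp Y H
  have he : NormedSpace.exp (-X) = NormedSpace.exp (-Y) * NormedSpace.exp (-Y) := by
    rw [← Matrix.exp_add_of_commute _ _ (Commute.refl _), hXY, neg_add]
  have hCe : C * NormedSpace.exp (-Y) = NormedSpace.exp (-Y) * C :=
    (hCY.neg_right.exp_right).eq
  have h1 : C * NormedSpace.exp (-X) * (NormedSpace.exp Y * D) =
      C * NormedSpace.exp (-Y) * D := by
    calc _ = C * NormedSpace.exp (-Y) * (NormedSpace.exp (-Y) * NormedSpace.exp Y) * D := by
          rw [he]; simp only [mul_assoc]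
      _ = _ := by rw [exp_neg_mul_exp, mul_one]
  have h2 : trace (C * NormedSpace.exp (-X) * (D * NormedSpace.exp Y)) =
      trace (C * NormedSpace.exp (-Y) * D) := by
    calc _ = trace ((C * NormedSpace.exp (-X) * D) * NormedSpace.exp Y) := by
          simp only [mul_assoc]
      _ = trace (NormedSpace.exp Y * (C * NormedSpace.exp (-Y)) * NormedSpace.exp (-Y) * D) := by
          rw [trace_mul_comm, he]; simp only [mul_assoc]
      _ = trace (NormedSpace.exp Y * NormedSpace.exp (-Y) * (C * NormedSpace.exp (-Y)) * D) := by
          rw [hCe]; simp only [mul_assoc]; rw [← mul_assoc C, hCe]; simp only [mul_assoc]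
      _ = _ := by rw [exp_mul_exp_neg, one_mul]
  rw [hD, mul_smul_comm, trace_smul, mul_add, trace_add, h1, h2, ← two_smul ℝ, smul_smul]
  norm_num

/-- The first variation of the exponential, tested against a matrix `C` that commutes with `X`. -/
theorem trace_mul_exp_neg_mul_fderiv_exp {X C : Matrix ι ι ℂ} (hC : Commute C X)
    (H : Matrix ι ι ℂ) :
    trace (C * NormedSpace.exp (-X) * fderiv ℝ NormedSpace.exp X H) = trace (C * H) := by
  let g : Matrix ι ι ℂ → ℂ := fun W =>
    trace (C * NormedSpace.exp (-W) * fderiv ℝ NormedSpace.exp W H)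
  have hg : Continuous g := by
    have h1 : Continuous (fun W : Matrix ι ι ℂ => fderiv ℝ NormedSpace.exp W H) :=
      (((contDiff_exp (ι := ι) (n := 1)).continuous_fderiv (by norm_num))).clm_apply
        continuous_const
    have h2 : Continuous (fun W : Matrix ι ι ℂ => NormedSpace.exp (-W)) :=
      (contDiff_exp (ι := ι) (n := 1)).continuous.comp continuous_neg
    exact Continuous.matrix_trace ((continuous_const.mul h2).mul h1)
  -- Halving repeatedly moves the base point to `0`, where the derivative of the exponential is the
  -- identity.
  have hpow : ∀ k : ℕ, g X = g (((1 / 2 : ℝ) ^ k) • X) := by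
    intro k
    induction k with
    | zero => simp
    | succ k ih =>
      rw [ih, pow_succ', ← smul_smul]
      exact trace_mul_exp_neg_mul_fderiv_exp_half (hC.smul_right _) H
  have hlim : Tendsto (fun k : ℕ => g (((1 / 2 : ℝ) ^ k) • X)) atTop (𝓝 (g 0)) := by
    refine (hg.tendsto 0).comp ?_
    have := (tendsto_pow_atTop_nhds_zero_of_lt_one (r := (1 / 2 : ℝ)) (by norm_num)
      (by norm_num)).smul_const X
    simpa using this
  have h0 : g X = g 0 := by
    refine tendsto_nhds_unique ?_ hlim
    simp only [← hpow]
    exact tendsto_const_nhds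
  have hz : fderiv ℝ (NormedSpace.exp : Matrix ι ι ℂ → Matrix ι ι ℂ) 0 = 1 :=
    (hasFDerivAt_exp_zero (𝕂 := ℝ)).fderiv
  calc _ = g 0 := h0
    _ = _ := by simp [g, hz, NormedSpace.exp_zero]

end General

end Grassmann

end FrobeniusAlgebra

/-! ### Unitary conjugation, the Gauss lemma and the radial curves. -/

section FrobeniusGrassmann

attribute [local instance] Matrix.frobeniusNormedRing Matrix.frobeniusNormedAlgebra

open Filter Topology

namespace Grassmann

section Conj

variable {ι : Type*} [Fintype ι] [DecidableEq ι]

theorem conjTranspose_exp_conj {X V : Matrix ι ι ℂ} (hX : Xᴴ = -X) (hV : Vᴴ = V) :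
    (NormedSpace.exp X * V * NormedSpace.exp (-X))ᴴ =
      NormedSpace.exp X * V * NormedSpace.exp (-X) := by
  have hX' : (-X)ᴴ = -(-X) := by rw [conjTranspose_neg, hX]
  rw [conjTranspose_mul, conjTranspose_mul, conjTranspose_exp hX, conjTranspose_exp hX', hV,
    neg_neg, mul_assoc]

theorem exp_conj_mul_exp_conj (X V W : Matrix ι ι ℂ) :
    (NormedSpace.exp X * V * NormedSpace.exp (-X)) *
      (NormedSpace.exp X * W * NormedSpace.exp (-X)) =
      NormedSpace.exp X * (V * W) * NormedSpace.exp (-X) := by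
  calc _ = NormedSpace.exp X * V * (NormedSpace.exp (-X) * NormedSpace.exp X) * W *
        NormedSpace.exp (-X) := by simp only [mul_assoc]
    _ = _ := by rw [exp_neg_mul_exp, mul_one]; simp only [mul_assoc]

theorem trace_exp_conj (X V : Matrix ι ι ℂ) :
    trace (NormedSpace.exp X * V * NormedSpace.exp (-X)) = trace V := by
  rw [trace_mul_comm, ← mul_assoc, exp_neg_mul_exp, one_mul]

theorem metric_exp_conj (X V W : Matrix ι ι ℂ) :
    metric (NormedSpace.exp X * V * NormedSpace.exp (-X))
      (NormedSpace.exp X * W * NormedSpace.exp (-X)) = metric V W := by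
  rw [metric, exp_conj_mul_exp_conj, trace_exp_conj, metric]

theorem norm_exp_conj {X V : Matrix ι ι ℂ} (hX : Xᴴ = -X) (hV : Vᴴ = V) :
    ‖NormedSpace.exp X * V * NormedSpace.exp (-X)‖ = ‖V‖ := by
  refine (sq_eq_sq₀ (norm_nonneg _) (norm_nonneg _)).1 ?_
  rw [← metric_self (conjTranspose_exp_conj hX hV), metric_exp_conj, metric_self hV]

end Conj

variable {m k : ℕ}

theorem conjTranspose_blockZ (Z : Matrix (Fin k) (Fin m) ℂ) : (blockZ Z)ᴴ = -blockZ Z := by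
  simp [blockZ, fromBlocks_conjTranspose, fromBlocks_neg]

theorem conjTranspose_stdProj : (stdProj m k)ᴴ = stdProj m k := by
  simp [stdProj, fromBlocks_conjTranspose]

theorem lie_blockZ_stdProj (Z : Matrix (Fin k) (Fin m) ℂ) :
    ⁅blockZ Z, stdProj m k⁆ = fromBlocks 0 Zᴴ Z 0 := by
  simp [Ring.lie_def, blockZ, stdProj, fromBlocks_multiply, sub_eq_add_neg, fromBlocks_neg,
    fromBlocks_add]

theorem conjTranspose_lie (Z : Matrix (Fin k) (Fin m) ℂ) :
    ⁅blockZ Z, stdProj m k⁆ᴴ = ⁅blockZ Z, stdProj m k⁆ := by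
  simp [lie_blockZ_stdProj, fromBlocks_conjTranspose]

/-- Bracketing twice with `E` is the identity on block-antidiagonal matrices. In the Gauss lemma
this turns the radial vector back into `𝒵`, which commutes with its own exponential. -/
theorem stdProj_mul_lie_sub (Z : Matrix (Fin k) (Fin m) ℂ) :
    stdProj m k * ⁅blockZ Z, stdProj m k⁆ - ⁅blockZ Z, stdProj m k⁆ * stdProj m k =
      -blockZ Z := by
  rw [lie_blockZ_stdProj]
  simp [blockZ, stdProj, fromBlocks_multiply, sub_eq_add_neg, fromBlocks_neg,
    fromBlocks_add]

theorem norm_lie_sq_eq_neg_trace (Z : Matrix (Fin k) (Fin m) ℂ) :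
    ‖⁅blockZ Z, stdProj m k⁆‖ ^ 2 = -(trace (blockZ Z * blockZ Z)).re := by
  rw [← metric_self (conjTranspose_lie Z), metric, lie_blockZ_stdProj]
  simp [blockZ, fromBlocks_multiply, trace, add_comm, ← sub_eq_add_neg]

/-- `Z` occurs in two blocks. Hence the level sets of the radial distance are Frobenius spheres in
`Z`. -/
theorem norm_lie_sq (Z : Matrix (Fin k) (Fin m) ℂ) :
    ‖⁅blockZ Z, stdProj m k⁆‖ ^ 2 = 2 * ‖Z‖ ^ 2 := by
  have h : ∀ {p q : Type} [Fintype p] [Fintype q] (A : Matrix p q ℂ),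
      ‖A‖ ^ 2 = ∑ i, ∑ j, ‖A i j‖ ^ 2 := by
    intro p q _ _ A
    rw [Matrix.frobenius_norm_def, ← Real.rpow_natCast, ← Real.rpow_mul (by positivity)]
    norm_num
  rw [lie_blockZ_stdProj, h, h]
  simp only [Fintype.sum_sum_type, fromBlocks_apply₁₁, fromBlocks_apply₁₂, fromBlocks_apply₂₁,
    fromBlocks_apply₂₂, conjTranspose_apply, norm_star, Matrix.zero_apply, norm_zero]
  have hs : ∑ i : Fin m, ∑ j : Fin k, ‖Z j i‖ ^ 2 = ∑ j, ∑ i, ‖Z j i‖ ^ 2 := Finset.sum_comm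
  simp [two_mul, hs]

/-- `blockZ` as a real linear map. -/
noncomputable def blockZL (m k : ℕ) :
    Matrix (Fin k) (Fin m) ℂ →L[ℝ] Matrix (Fin m ⊕ Fin k) (Fin m ⊕ Fin k) ℂ :=
  LinearMap.toContinuousLinearMap
    { toFun := blockZ
      map_add' := fun Z W => by simp [blockZ, fromBlocks_add, add_comm]
      map_smul' := fun c Z => by simp [blockZ, fromBlocks_smul, conjTranspose_smul] }

theorem contDiff_rotated {n : WithTop ℕ∞} :
    ContDiff ℝ n (rotated : Matrix (Fin k) (Fin m) ℂ → _) := by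
  have h1 : ContDiff ℝ n (fun Z : Matrix (Fin k) (Fin m) ℂ => NormedSpace.exp (blockZ Z)) :=
    contDiff_exp.comp (blockZL m k).contDiff
  have h2 : ContDiff ℝ n (fun Z : Matrix (Fin k) (Fin m) ℂ => NormedSpace.exp (-blockZ Z)) :=
    contDiff_exp.comp (blockZL m k).contDiff.neg
  exact (h1.mul contDiff_const).mul h2

theorem rotated_zero : rotated (0 : Matrix (Fin k) (Fin m) ℂ) = stdProj m k := by
  have h : blockZ (0 : Matrix (Fin k) (Fin m) ℂ) = 0 := (blockZL m k).map_zero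
  simp [rotated, h, NormedSpace.exp_zero]

theorem stdProj_mem_Gr : stdProj m k ∈ Gr m (Fin m ⊕ Fin k) := by
  refine ⟨conjTranspose_stdProj, ?_, ?_⟩ <;>
  simp [stdProj, fromBlocks_multiply, trace]

theorem rotated_mem_Gr (Z : Matrix (Fin k) (Fin m) ℂ) : rotated Z ∈ Gr m (Fin m ⊕ Fin k) := by
  obtain ⟨h1, h2, h3⟩ := stdProj_mem_Gr (m := m) (k := k)
  refine ⟨conjTranspose_exp_conj (conjTranspose_blockZ Z) h1, ?_, ?_⟩
  · rw [rotated, exp_conj_mul_exp_conj, h2]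
  · rw [rotated, trace_exp_conj, h3]

/-- The Gauss lemma, in the form of the inequality it gives for the speed of a curve. -/
theorem neg_re_trace_le_of_hasDerivAt {w : ℝ → Matrix (Fin k) (Fin m) ℂ}
    {w' : Matrix (Fin k) (Fin m) ℂ} {γ : ℝ → Matrix (Fin m ⊕ Fin k) (Fin m ⊕ Fin k) ℂ}
    {γ' : Matrix (Fin m ⊕ Fin k) (Fin m ⊕ Fin k) ℂ} {t : ℝ}
    (hw : HasDerivAt w w' t) (hγ : HasDerivAt γ γ' t) (hγw : γ =ᶠ[𝓝 t] rotated ∘ w)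
    (hγ' : γ'ᴴ = γ') :
    -(trace (blockZ (w t) * blockZ w')).re ≤ ‖⁅blockZ (w t), stdProj m k⁆‖ * ‖γ'‖ := by
  set X := blockZ (w t) with hX
  set E := stdProj m k
  set V := ⁅X, E⁆
  have hbw : HasDerivAt (fun s => blockZ (w s)) (blockZ w') t :=
    (blockZL m k).hasFDerivAt.comp_hasDerivAt t hw
  have hd : ∀ W : Matrix (Fin m ⊕ Fin k) (Fin m ⊕ Fin k) ℂ,
      HasFDerivAt (𝕜 := ℝ) NormedSpace.exp (fderiv ℝ NormedSpace.exp W) W :=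
    fun W => ((contDiff_exp (n := 1)).differentiable (by norm_num) W).hasFDerivAt
  have h1 : HasDerivAt (fun s => NormedSpace.exp (blockZ (w s)))
      (fderiv ℝ NormedSpace.exp X (blockZ w')) t := (hd X).comp_hasDerivAt t hbw
  have h2 : HasDerivAt (fun s => NormedSpace.exp (-blockZ (w s)))
      (fderiv ℝ NormedSpace.exp (-X) (-blockZ w')) t := (hd (-X)).comp_hasDerivAt t hbw.neg
  set D := fderiv ℝ NormedSpace.exp X (blockZ w') with hD
  set D' := fderiv ℝ NormedSpace.exp (-X) (-blockZ w')
  -- Differentiate `e^{-X} e^X = 1` along the curve to eliminate `D'`.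
  have h3 : NormedSpace.exp (-X) * D + D' * NormedSpace.exp X = 0 := by
    have h := h2.mul h1
    have hc : ((fun s => NormedSpace.exp (-blockZ (w s))) *
        fun s => NormedSpace.exp (blockZ (w s))) = fun _ => 1 :=
      funext fun s => exp_neg_mul_exp _
    rw [hc] at h
    rw [add_comm]
    exact h.unique (hasDerivAt_const t _)
  have h4 : γ' = D * E * NormedSpace.exp (-X) + NormedSpace.exp X * E * D' :=
    hγ.unique (((h1.mul_const E).mul h2).congr_of_eventuallyEq hγw)
  have h5 : D' * NormedSpace.exp X = -(NormedSpace.exp (-X) * D) := by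
    rw [eq_neg_iff_add_eq_zero, add_comm]; exact h3
  have hV : Vᴴ = V := conjTranspose_lie _
  -- Pairing with the radial vector: the two terms of `γ'` combine to `tr (e^{-X} D [E, V])`, where
  -- `[E, V] = -X`, so the first variation formula applies with `C = X`.
  have h6 : trace (γ' * (NormedSpace.exp X * V * NormedSpace.exp (-X))) =
      -trace (X * blockZ w') := by
    have e1 : trace (D * E * NormedSpace.exp (-X) * (NormedSpace.exp X * V * NormedSpace.exp (-X)))
        = trace (NormedSpace.exp (-X) * D * (E * V)) := by
      calc _ = trace (D * E * (NormedSpace.exp (-X) * NormedSpace.exp X) * V *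
              NormedSpace.exp (-X)) := by simp only [mul_assoc]
        _ = _ := by rw [exp_neg_mul_exp, mul_one, trace_mul_comm]; simp only [mul_assoc]
    have e2 : trace (NormedSpace.exp X * E * D' * (NormedSpace.exp X * V * NormedSpace.exp (-X)))
        = -trace (NormedSpace.exp (-X) * D * (V * E)) := by
      calc _ = trace (NormedSpace.exp X * (E * (D' * NormedSpace.exp X) * V) *
              NormedSpace.exp (-X)) := by simp only [mul_assoc]
        _ = trace (E * ((D' * NormedSpace.exp X) * V)) := by
            rw [trace_exp_conj, mul_assoc]
        _ = _ := by
            rw [trace_mul_comm, h5, neg_mul, neg_mul, trace_neg, mul_assoc _ V E]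
    rw [h4, add_mul, trace_add, e1, e2, ← sub_eq_add_neg, ← trace_sub, ← mul_sub,
      stdProj_mul_lie_sub, mul_neg, trace_neg, trace_mul_comm, ← hX, ← mul_assoc,
      trace_mul_exp_neg_mul_fderiv_exp (Commute.refl X)]
  have h7 := metric_le_norm_mul_norm hγ' (conjTranspose_exp_conj (conjTranspose_blockZ (w t)) hV)
  rw [norm_exp_conj (conjTranspose_blockZ (w t)) hV, metric, h6, Complex.neg_re] at h7
  rw [mul_comm]
  exact h7

/-- Differentiate `-tr 𝒵²`; cyclicity of the trace merges the two terms. The result is twice the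
quantity bounded by the Gauss lemma. -/
theorem hasDerivAt_norm_lie_sq {w : ℝ → Matrix (Fin k) (Fin m) ℂ}
    {w' : Matrix (Fin k) (Fin m) ℂ} {t : ℝ} (hw : HasDerivAt w w' t) :
    HasDerivAt (fun s => ‖⁅blockZ (w s), stdProj m k⁆‖ ^ 2)
      (2 * -(trace (blockZ (w t) * blockZ w')).re) t := by
  have hbw : HasDerivAt (fun s => blockZ (w s)) (blockZ w') t :=
    (blockZL m k).hasFDerivAt.comp_hasDerivAt t hw
  let T : Matrix (Fin m ⊕ Fin k) (Fin m ⊕ Fin k) ℂ →L[ℝ] ℝ :=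
    Complex.reCLM.comp (LinearMap.toContinuousLinearMap (traceLinearMap (Fin m ⊕ Fin k) ℝ ℂ))
  have h := (T.hasFDerivAt.comp_hasDerivAt t (hbw.mul hbw)).neg
  have h1 : (fun s => ‖⁅blockZ (w s), stdProj m k⁆‖ ^ 2) =
      fun s => -T (blockZ (w s) * blockZ (w s)) := funext fun s => norm_lie_sq_eq_neg_trace _
  rw [h1]
  convert! h using 1
  change _ = -(trace (blockZ w' * blockZ (w t) + blockZ (w t) * blockZ w')).re
  rw [trace_add, trace_mul_comm (blockZ w'), Complex.add_re]
  ring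

/-- The velocity of the curve `t ↦ e^{t𝒵} E e^{-t𝒵}`. -/
theorem hasDerivAt_rotated_smul (Z : Matrix (Fin k) (Fin m) ℂ) (t : ℝ) :
    HasDerivAt (fun t : ℝ => rotated (t • Z))
      (NormedSpace.exp (blockZ (t • Z)) * ⁅blockZ Z, stdProj m k⁆ *
        NormedSpace.exp (-blockZ (t • Z))) t := by
  set X := blockZ Z with hX
  set E := stdProj m k
  have hsm : ∀ t : ℝ, blockZ (t • Z) = t • X := fun t => (blockZL m k).map_smul t Z
  have h1 : HasDerivAt (fun s : ℝ => NormedSpace.exp (s • X)) (NormedSpace.exp (t • X) * X) t :=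
    hasDerivAt_exp_smul_const X t
  have h2 : HasDerivAt (fun s : ℝ => NormedSpace.exp (s • (-X)))
      (-X * NormedSpace.exp (t • (-X))) t := hasDerivAt_exp_smul_const' (-X) t
  have h3 := (h1.mul_const E).mul h2
  have h4 : (fun t : ℝ => rotated (t • Z)) =
      (fun s : ℝ => NormedSpace.exp (s • X) * E) * fun s : ℝ => NormedSpace.exp (s • (-X)) := by
    funext s
    simp only [rotated, hsm, Pi.mul_apply, smul_neg, E]
  rw [h4]
  convert! h3 using 1
  rw [hsm, smul_neg, Ring.lie_def]
  noncomm_ring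

/-- The curve `t ↦ e^{t𝒵} E e^{-t𝒵}` bounds the distance from above. -/
theorem geodesicDist_le (Z : Matrix (Fin k) (Fin m) ℂ) :
    geodesicDist m (stdProj m k) (rotated Z) ≤
      ENNReal.ofReal ‖⁅blockZ Z, stdProj m k⁆‖ := by
  have hc : IsCurve (Gr m (Fin m ⊕ Fin k)) (stdProj m k) (rotated Z)
      (fun t : ℝ => rotated (t • Z)) := by
    refine ⟨?_, fun t _ => rotated_mem_Gr _, ?_, ?_⟩
    · exact (contDiff_rotated.comp (contDiff_id.smul contDiff_const)).contDiffOn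
    · simp [rotated_zero]
    · simp
  have hlen : length (fun t : ℝ => rotated (t • Z)) = ‖⁅blockZ Z, stdProj m k⁆‖ := by
    have : ∀ t ∈ uIcc (0 : ℝ) 1,
        √(metric (derivWithin (fun t : ℝ => rotated (t • Z)) (Icc 0 1) t)
          (derivWithin (fun t : ℝ => rotated (t • Z)) (Icc 0 1) t)) = ‖⁅blockZ Z, stdProj m k⁆‖ := by
      intro t ht
      rw [uIcc_of_le zero_le_one] at ht
      have hd := (hasDerivAt_rotated_smul Z t).hasDerivWithinAt.derivWithin (uniqueDiffOn_Icc zero_lt_one t ht)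
      refine (congrArg₂ (fun A B => √(metric A B)) hd hd).trans ?_
      rw [metric_exp_conj, metric_self (conjTranspose_lie Z), Real.sqrt_sq (norm_nonneg _)]
    rw [length, intervalIntegral.integral_congr this]
    simp
  exact (iInf₂_le _ hc).trans (by rw [hlen])

end Grassmann

end FrobeniusGrassmann

/-! ### The exponential chart at the standard projector. -/

section FrobeniusChart

attribute [local instance] Matrix.frobeniusNormedRing Matrix.frobeniusNormedAlgebra

open Filter Topology

namespace Grassmann

variable {m k : ℕ}

/-- Idempotents near the standard projector with equal off-diagonal blocks are equal. -/
theorem exists_eq_of_toBlocks_eq (m k : ℕ) : ∃ ε : ℝ, 0 < ε ∧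
    ∀ P ∈ Metric.ball (stdProj m k) ε, ∀ Q ∈ Metric.ball (stdProj m k) ε,
      P * P = P → Q * Q = Q → P.toBlocks₂₁ = Q.toBlocks₂₁ → P.toBlocks₁₂ = Q.toBlocks₁₂ →
      P = Q := by
  set E := stdProj m k with hE
  set K := ‖1 - 2 • E‖
  have hK : 0 ≤ K := norm_nonneg _
  refine ⟨1 / (4 * (K + 1)), by positivity, fun P hP Q hQ hPP hQQ h21 h12 => ?_⟩
  rw [mem_ball_iff_norm, lt_div_iff₀ (by positivity)] at hP hQ
  -- The difference is block diagonal.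
  have hN : E * (P - Q) = (P - Q) * E := by
    rw [← fromBlocks_toBlocks P, ← fromBlocks_toBlocks Q, h21, h12, sub_eq_add_neg, fromBlocks_neg,
      fromBlocks_add]
    simp [hE, stdProj, fromBlocks_multiply]
  have hEE : E * E = E := stdProj_mem_Gr.2.1
  set N := P - Q
  have h1 : N = P * N + N * Q := by
    simp only [N, mul_sub, sub_mul, hPP, hQQ]
    abel
  have h2 : (1 - 2 • E) * N = (P - E) * N + N * (Q - E) := by
    calc (1 - 2 • E) * N = N - E * N - E * N := by noncomm_ring
      _ = (P * N + N * Q) - E * N - N * E := by rw [← h1, ← hN]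
      _ = _ := by noncomm_ring
  -- As `1 - 2E` is an involution, `N` is at most `K (‖P - E‖ + ‖Q - E‖) < 1` times itself in norm,
  -- which forces `N = 0`.
  have h3 : N = (1 - 2 • E) * ((P - E) * N + N * (Q - E)) := by
    rw [← h2, ← mul_assoc]
    have : (1 - 2 • E) * (1 - 2 • E) = 1 - 4 • E + 4 • (E * E) := by noncomm_ring
    rw [this, hEE, sub_add_cancel, one_mul]
  have h4 : ‖N‖ ≤ K * (‖P - E‖ * ‖N‖ + ‖N‖ * ‖Q - E‖) := by
    conv_lhs => rw [h3]
    refine (norm_mul_le _ _).trans (mul_le_mul_of_nonneg_left ?_ hK)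
    exact (norm_add_le _ _).trans (add_le_add (norm_mul_le _ _) (norm_mul_le _ _))
  have h5 : ‖N‖ = 0 := by
    by_contra h
    have hpos : 0 < ‖N‖ := lt_of_le_of_ne (norm_nonneg _) (Ne.symm h)
    have h6 : 1 ≤ K * (‖P - E‖ + ‖Q - E‖) := by
      refine le_of_mul_le_mul_right ?_ hpos
      linarith
    nlinarith [norm_nonneg (P - E), norm_nonneg (Q - E)]
  exact sub_eq_zero.1 (norm_eq_zero.1 h5)

/-- The lower left block as a real linear map. -/
noncomputable def toBlocks₂₁L (m k : ℕ) :
    Matrix (Fin m ⊕ Fin k) (Fin m ⊕ Fin k) ℂ →L[ℝ] Matrix (Fin k) (Fin m) ℂ :=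
  LinearMap.toContinuousLinearMap
    { toFun := toBlocks₂₁
      map_add' := fun _ _ => rfl
      map_smul' := fun _ _ => rfl }

/-- The lower left block of `rotated Z` agrees with `Z` to first order at `0`. -/
theorem hasFDerivAt_toBlocks₂₁_rotated :
    HasFDerivAt (𝕜 := ℝ) (fun Z : Matrix (Fin k) (Fin m) ℂ => toBlocks₂₁L m k (rotated Z))
      (ContinuousLinearEquiv.refl ℝ (Matrix (Fin k) (Fin m) ℂ) :
        Matrix (Fin k) (Fin m) ℂ →L[ℝ] Matrix (Fin k) (Fin m) ℂ) 0 := by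
  have h1 := ((contDiff_rotated (m := m) (k := k) (n := 1)).differentiable
    (by norm_num) 0).hasFDerivAt
  have h2 := (toBlocks₂₁L m k).hasFDerivAt.comp 0 h1
  convert! h2 using 1
  ext1 H
  -- The derivative is read off along the line `t • H`, where the velocity is known.
  have hl : HasDerivAt (fun t : ℝ => t • H) H 0 := by
    have h := (hasDerivAt_id (0 : ℝ)).smul_const H
    rwa [one_smul] at h
  have h1' : HasFDerivAt (𝕜 := ℝ) (rotated (m := m) (k := k)) (fderiv ℝ rotated 0) ((0 : ℝ) • H) := by
    rw [zero_smul]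
    exact h1
  have h3 := h1'.comp_hasDerivAt 0 hl
  have h4 := h3.unique (hasDerivAt_rotated_smul H 0)
  have hz : blockZ (0 : Matrix (Fin k) (Fin m) ℂ) = 0 := (blockZL m k).map_zero
  rw [zero_smul, hz, neg_zero, NormedSpace.exp_zero, one_mul, mul_one, lie_blockZ_stdProj] at h4
  have h5 := congrArg toBlocks₂₁ h4
  rw [toBlocks_fromBlocks₂₁] at h5
  exact h5.symm

/-- A local logarithm: near the standard projector, `rotated` has a differentiable left inverse
and maps small balls onto relatively open subsets of the Grassmannian. -/
theorem exists_log (m k : ℕ) : ∃ r₀ : ℝ, 0 < r₀ ∧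
    ∃ L : Matrix (Fin m ⊕ Fin k) (Fin m ⊕ Fin k) ℂ → Matrix (Fin k) (Fin m) ℂ,
      (∀ Z ∈ Metric.ball (0 : Matrix (Fin k) (Fin m) ℂ) r₀, L (rotated Z) = Z) ∧
      (∀ Z ∈ Metric.ball (0 : Matrix (Fin k) (Fin m) ℂ) r₀, DifferentiableAt ℝ L (rotated Z)) ∧
      ∀ r ≤ r₀, ∃ O : Set (Matrix (Fin m ⊕ Fin k) (Fin m ⊕ Fin k) ℂ), IsOpen O ∧
        rotated '' Metric.ball (0 : Matrix (Fin k) (Fin m) ℂ) r =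
          O ∩ Gr m (Fin m ⊕ Fin k) := by
  obtain ⟨ε, hε, hinj⟩ := exists_eq_of_toBlocks_eq m k
  set b := toBlocks₂₁L m k
  set β : Matrix (Fin k) (Fin m) ℂ → Matrix (Fin k) (Fin m) ℂ := fun Z => b (rotated Z)
  have hβ : ContDiff ℝ 1 β := b.contDiff.comp contDiff_rotated
  have hβ' := hasFDerivAt_toBlocks₂₁_rotated (m := m) (k := k)
  let e := hβ.contDiffAt.toOpenPartialHomeomorph β hβ' one_ne_zero
  have he : ∀ Z, e Z = β Z := fun Z => rfl
  have h0 : (0 : Matrix (Fin k) (Fin m) ℂ) ∈ e.source :=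
    hβ.contDiffAt.mem_toOpenPartialHomeomorph_source hβ' one_ne_zero
  have hL : ContDiffAt ℝ 1 e.symm (β 0) := hβ.contDiffAt.to_localInverse hβ' one_ne_zero
  have hev1 : ∀ᶠ Z in 𝓝 (0 : Matrix (Fin k) (Fin m) ℂ), ContDiffAt ℝ 1 e.symm (β Z) :=
    hβ.continuous.continuousAt.eventually (hL.eventually (by simp))
  have hev2 : ∀ᶠ Z in 𝓝 (0 : Matrix (Fin k) (Fin m) ℂ),
      rotated Z ∈ Metric.ball (stdProj m k) ε := by
    refine (contDiff_rotated (n := 1)).continuous.continuousAt.eventually_mem ?_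
    rw [rotated_zero]
    exact Metric.ball_mem_nhds _ hε
  obtain ⟨r₀, hr₀, hball⟩ := Metric.eventually_nhds_iff_ball.1
    (hev1.and (hev2.and (e.open_source.eventually_mem h0)))
  refine ⟨r₀, hr₀, e.symm ∘ b, fun Z hZ => e.left_inv (hball Z hZ).2.2, fun Z hZ => ?_,
    fun r hr => ?_⟩
  · exact DifferentiableAt.comp (rotated Z) ((hball Z hZ).1.differentiableAt one_ne_zero)
      b.differentiableAt
  · have hsub : Metric.ball (0 : Matrix (Fin k) (Fin m) ℂ) r ⊆ Metric.ball 0 r₀ :=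
      Metric.ball_subset_ball hr
    refine ⟨Metric.ball (stdProj m k) ε ∩ b ⁻¹' (e '' Metric.ball 0 r),
      Metric.isOpen_ball.inter ((e.isOpen_image_of_subset_source Metric.isOpen_ball
        fun Z hZ => (hball Z (hsub hZ)).2.2).preimage b.continuous), ?_⟩
    apply Subset.antisymm
    · rintro _ ⟨Z, hZ, rfl⟩
      exact ⟨⟨(hball Z (hsub hZ)).2.1, Z, hZ, rfl⟩, rotated_mem_Gr Z⟩
    -- Only the lower left blocks are known to agree; Hermitian symmetry gives the upper right ones.
    · rintro P ⟨⟨hP, Z, hZ, hZP⟩, hPh, hPP, -⟩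
      obtain ⟨hQh, hQQ, -⟩ := rotated_mem_Gr Z
      have h21 : (rotated Z).toBlocks₂₁ = P.toBlocks₂₁ := hZP
      refine ⟨Z, hZ, hinj _ (hball Z (hsub hZ)).2.1 _ hP hQQ hPP h21 ?_⟩
      have h12 : ∀ A : Matrix (Fin m ⊕ Fin k) (Fin m ⊕ Fin k) ℂ, Aᴴ = A →
          A.toBlocks₁₂ = A.toBlocks₂₁ᴴ := fun A hA => by
        conv_lhs => rw [← hA]
        rfl
      rw [h12 _ hQh, h12 _ hPh, h21]

end Grassmann

end FrobeniusChart

/-! ### Lower bound for the length of an arbitrary curve. -/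

section GeodesicLowerBound

open Filter Topology MeasureTheory

namespace Grassmann

variable {m k : ℕ}

/-- The Hermitian condition is real linear, so it passes to velocities. On them the metric is
therefore the squared Frobenius norm. -/
theorem IsCurve.conjTranspose_derivWithin {P Q : Matrix (Fin m ⊕ Fin k) (Fin m ⊕ Fin k) ℂ}
    {γ : ℝ → Matrix (Fin m ⊕ Fin k) (Fin m ⊕ Fin k) ℂ}
    (hγ : IsCurve (Gr m (Fin m ⊕ Fin k)) P Q γ) {t : ℝ} (ht : t ∈ Icc (0 : ℝ) 1) :
    (derivWithin γ (Icc 0 1) t)ᴴ = derivWithin γ (Icc 0 1) t := by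
  have hd := (hγ.contDiffOn.differentiableOn one_ne_zero t ht).hasDerivWithinAt
  let S : Matrix (Fin m ⊕ Fin k) (Fin m ⊕ Fin k) ℂ →L[ℝ]
      Matrix (Fin m ⊕ Fin k) (Fin m ⊕ Fin k) ℂ :=
    LinearMap.toContinuousLinearMap
      { toFun := conjTranspose
        map_add' := conjTranspose_add
        map_smul' := fun c A => by simp [conjTranspose_smul] }
  have h1 : HasDerivWithinAt (fun s => (γ s)ᴴ) (derivWithin γ (Icc 0 1) t)ᴴ (Icc 0 1) t :=
    S.hasFDerivAt.comp_hasDerivWithinAt t hd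
  have h2 : HasDerivWithinAt γ (derivWithin γ (Icc 0 1) t)ᴴ (Icc 0 1) t :=
    h1.congr (fun s hs => (hγ.mapsTo hs).1.symm) (hγ.mapsTo ht).1.symm
  exact (uniqueDiffOn_Icc zero_lt_one t ht).eq_deriv _ h2 hd

theorem IsCurve.length_eq {P Q : Matrix (Fin m ⊕ Fin k) (Fin m ⊕ Fin k) ℂ}
    {γ : ℝ → Matrix (Fin m ⊕ Fin k) (Fin m ⊕ Fin k) ℂ}
    (hγ : IsCurve (Gr m (Fin m ⊕ Fin k)) P Q γ) :
    length γ = ∫ t in (0 : ℝ)..1, ‖derivWithin γ (Icc 0 1) t‖ := by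
  refine intervalIntegral.integral_congr fun t ht => ?_
  rw [uIcc_of_le zero_le_one] at ht
  rw [metric_self (hγ.conjTranspose_derivWithin ht), Real.sqrt_sq (norm_nonneg _)]

/-- A curve that starts at the standard projector and is the image under `rotated` of a curve
`w` up to time `T` is at least as long as the radial distance covered by `w`. -/
theorem IsCurve.norm_lie_le_length {Q : Matrix (Fin m ⊕ Fin k) (Fin m ⊕ Fin k) ℂ}
    {γ : ℝ → Matrix (Fin m ⊕ Fin k) (Fin m ⊕ Fin k) ℂ}
    (hγ : IsCurve (Gr m (Fin m ⊕ Fin k)) (stdProj m k) Q γ)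
    {w : ℝ → Matrix (Fin k) (Fin m) ℂ} {T : ℝ} (hT0 : 0 ≤ T) (hT1 : T ≤ 1)
    (hwc : ContinuousOn w (Icc 0 T)) (hwd : ∀ t ∈ Ioo 0 T, DifferentiableAt ℝ w t)
    (hw0 : w 0 = 0) (hγw : ∀ t ∈ Icc 0 T, γ t = rotated (w t)) :
    ‖⁅blockZ (w T), stdProj m k⁆‖ ≤ length γ := by
  set v : ℝ → ℝ := fun t => ‖derivWithin γ (Icc 0 1) t‖
  set q : ℝ → ℝ := fun t => ‖⁅blockZ (w t), stdProj m k⁆‖ ^ 2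
  have hv : ContinuousOn v (Icc 0 1) :=
    (hγ.contDiffOn.continuousOn_derivWithin (uniqueDiffOn_Icc zero_lt_one) le_rfl).norm
  have hsub : Icc (0 : ℝ) T ⊆ Icc 0 1 := Icc_subset_Icc_right hT1
  have hq : ContinuousOn q (Icc 0 T) := by
    have h : q = fun t => 2 * ‖w t‖ ^ 2 := funext fun t => norm_lie_sq _
    rw [h]
    exact continuousOn_const.mul (hwc.norm.pow 2)
  have hq0 : ∀ t, 0 ≤ q t := fun t => sq_nonneg _
  have hint : ∫ t in (0 : ℝ)..T, v t ≤ length γ := by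
    rw [hγ.length_eq]
    refine intervalIntegral.integral_mono_interval le_rfl hT0 hT1
      (Eventually.of_forall fun t => norm_nonneg _) ?_
    exact ContinuousOn.intervalIntegrable_of_Icc zero_le_one hv
  -- The radius `√q` need not be differentiable where `w` vanishes, so `√(q + ε²)` is used instead,
  -- at the cost of an error `ε`.
  refine le_of_forall_pos_le_add fun ε hε => ?_
  have hpos : ∀ t, 0 < q t + ε ^ 2 := fun t => add_pos_of_nonneg_of_pos (hq0 t) (by positivity)
  have key : √(q T + ε ^ 2) - √(q 0 + ε ^ 2) ≤ ∫ t in (0 : ℝ)..T, v t := by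
    refine intervalIntegral.sub_le_integral_of_hasDeriv_right_of_le hT0
      (g := fun t => √(q t + ε ^ 2))
      (g' := fun t => (2 * -(trace (blockZ (w t) * blockZ (deriv w t))).re) /
        (2 * √(q t + ε ^ 2)))
      (hq.add continuousOn_const).sqrt (fun t ht => ?_)
      ((hv.mono hsub).integrableOn_Icc) (fun t ht => ?_)
    · exact (((hasDerivAt_norm_lie_sq (hwd t ht).hasDerivAt).add_const (ε ^ 2)).sqrt
        (hpos t).ne').hasDerivWithinAt
    · have htI : t ∈ Icc (0 : ℝ) 1 := hsub (Ioo_subset_Icc_self ht)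
      have hn : Icc (0 : ℝ) 1 ∈ 𝓝 t := Icc_mem_nhds ht.1 (ht.2.trans_le hT1)
      have hγd : HasDerivAt γ (derivWithin γ (Icc 0 1) t) t :=
        (hγ.contDiffOn.differentiableOn one_ne_zero t htI).hasDerivWithinAt.hasDerivAt hn
      have hev : γ =ᶠ[𝓝 t] rotated ∘ w := by
        filter_upwards [Ioo_mem_nhds ht.1 ht.2] with s hs
        exact hγw s (Ioo_subset_Icc_self hs)
      have hG := neg_re_trace_le_of_hasDerivAt (hwd t ht).hasDerivAt hγd hev
        (hγ.conjTranspose_derivWithin htI)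
      have hle : ‖⁅blockZ (w t), stdProj m k⁆‖ ≤ √(q t + ε ^ 2) :=
        Real.le_sqrt_of_sq_le (le_add_of_nonneg_right (sq_nonneg ε))
      have hs : 0 < √(q t + ε ^ 2) := Real.sqrt_pos.2 (hpos t)
      rw [div_le_iff₀ (by positivity)]
      have := mul_le_mul_of_nonneg_right hle (norm_nonneg (derivWithin γ (Icc 0 1) t))
      calc _ ≤ 2 * (√(q t + ε ^ 2) * v t) :=
            mul_le_mul_of_nonneg_left (hG.trans this) zero_le_two
        _ = _ := by ring
  have h0 : √(q 0 + ε ^ 2) = ε := by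
    have h : q 0 = 0 := by
      change ‖⁅blockZ (w 0), stdProj m k⁆‖ ^ 2 = 0
      rw [norm_lie_sq, hw0, norm_zero]
      norm_num
    rw [h, zero_add, Real.sqrt_sq hε.le]
  have hfin : ‖⁅blockZ (w T), stdProj m k⁆‖ ≤ √(q T + ε ^ 2) :=
    Real.le_sqrt_of_sq_le (le_add_of_nonneg_right (sq_nonneg ε))
  linarith

theorem length_nonneg {ι : Type*} [Fintype ι] (γ : ℝ → Matrix ι ι ℂ) : 0 ≤ length γ :=
  intervalIntegral.integral_nonneg zero_le_one fun _ _ => Real.sqrt_nonneg _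

/-- Inside the domain of a local logarithm, no curve is shorter than the geodesic. -/
theorem norm_lie_le_length {r₀ : ℝ}
    {L : Matrix (Fin m ⊕ Fin k) (Fin m ⊕ Fin k) ℂ → Matrix (Fin k) (Fin m) ℂ}
    (hL : ∀ Z ∈ Metric.ball (0 : Matrix (Fin k) (Fin m) ℂ) r₀, L (rotated Z) = Z)
    (hLd : ∀ Z ∈ Metric.ball (0 : Matrix (Fin k) (Fin m) ℂ) r₀, DifferentiableAt ℝ L (rotated Z))
    (hO : ∀ r ≤ r₀, ∃ O : Set (Matrix (Fin m ⊕ Fin k) (Fin m ⊕ Fin k) ℂ), IsOpen O ∧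
        rotated '' Metric.ball (0 : Matrix (Fin k) (Fin m) ℂ) r = O ∩ Gr m (Fin m ⊕ Fin k))
    {Z : Matrix (Fin k) (Fin m) ℂ} (hZ : Z ∈ Metric.ball (0 : Matrix (Fin k) (Fin m) ℂ) r₀)
    {γ : ℝ → Matrix (Fin m ⊕ Fin k) (Fin m ⊕ Fin k) ℂ}
    (hγ : IsCurve (Gr m (Fin m ⊕ Fin k)) (stdProj m k) (rotated Z) γ) :
    ‖⁅blockZ Z, stdProj m k⁆‖ ≤ length γ := by
  have hZr : ‖Z‖ < r₀ := mem_ball_zero_iff.1 hZ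
  rcases eq_or_ne Z 0 with rfl | hZ0
  · have h : ‖⁅blockZ (0 : Matrix (Fin k) (Fin m) ℂ), stdProj m k⁆‖ ^ 2 = 0 := by
      rw [norm_lie_sq, norm_zero]; norm_num
    rw [pow_eq_zero_iff two_ne_zero] at h
    rw [h]
    exact length_nonneg γ
  set c := ‖Z‖ with hc
  have hc0 : 0 < c := norm_pos_iff.2 hZ0
  have hcb : Metric.closedBall (0 : Matrix (Fin k) (Fin m) ℂ) c ⊆ Metric.ball 0 r₀ :=
    Metric.closedBall_subset_ball hZr
  obtain ⟨O, hOo, hOeq⟩ := hO c hZr.le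
  have hγc : ContinuousOn γ (Icc 0 1) := hγ.contDiffOn.continuousOn
  have hmemO : ∀ W ∈ Metric.ball (0 : Matrix (Fin k) (Fin m) ℂ) c, rotated W ∈ O :=
    fun W hW => (hOeq.subset ⟨W, hW, rfl⟩).1
  -- The times at which `γ` is outside the image of the open ball of radius `‖Z‖`. The set is closed
  -- and contains `1` by injectivity of `rotated`, so a first exit time exists.
  set S : Set ℝ := Icc 0 1 ∩ γ ⁻¹' Oᶜ
  have hS : IsClosed S := hγc.preimage_isClosed_of_isClosed isClosed_Icc hOo.isClosed_compl
  have h1S : (1 : ℝ) ∈ S := by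
    refine ⟨right_mem_Icc.2 zero_le_one, fun h => ?_⟩
    rw [hγ.target] at h
    obtain ⟨W, hW, hWZ⟩ := hOeq.superset ⟨h, rotated_mem_Gr Z⟩
    have hW' := hL W (hcb (Metric.ball_subset_closedBall hW))
    rw [hWZ, hL Z hZ] at hW'
    rw [mem_ball_zero_iff, ← hW'] at hW
    exact lt_irrefl _ hW
  have hbdd : BddBelow S := ⟨0, fun t ht => ht.1.1⟩
  set T := sInf S
  have hTS : T ∈ S := hS.csInf_mem ⟨1, h1S⟩ hbdd
  have hT0 : 0 < T := by
    refine lt_of_le_of_ne hTS.1.1 fun h => hTS.2 ?_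
    rw [← h, hγ.source, ← rotated_zero]
    exact hmemO 0 (Metric.mem_ball_self hc0)
  have hbefore : ∀ t ∈ Ico 0 T, γ t ∈ rotated '' Metric.ball (0 : Matrix (Fin k) (Fin m) ℂ) c := by
    intro t ht
    have htI : t ∈ Icc (0 : ℝ) 1 := ⟨ht.1, ht.2.le.trans hTS.1.2⟩
    rw [hOeq]
    refine ⟨?_, hγ.mapsTo htI⟩
    by_contra h
    exact (csInf_le hbdd ⟨htI, h⟩).not_gt ht.2
  have hK : IsClosed (rotated '' Metric.closedBall (0 : Matrix (Fin k) (Fin m) ℂ) c) :=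
    ((isCompact_closedBall (0 : Matrix (Fin k) (Fin m) ℂ) c).image
      (contDiff_rotated (n := 1)).continuous).isClosed
  have hTcl : T ∈ closure (Ico 0 T) := by
    rw [closure_Ico hT0.ne]
    exact right_mem_Icc.2 hT0.le
  have hTK : γ T ∈ rotated '' Metric.closedBall (0 : Matrix (Fin k) (Fin m) ℂ) c := by
    have hcont : ContinuousWithinAt γ (Ico 0 T) T :=
      (hγc T hTS.1).mono fun t ht => ⟨ht.1, ht.2.le.trans hTS.1.2⟩
    have hsub : γ '' Ico 0 T ⊆ rotated '' Metric.closedBall 0 c := by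
      rintro _ ⟨t, ht, rfl⟩
      exact image_mono Metric.ball_subset_closedBall (hbefore t ht)
    exact closure_minimal hsub hK (hcont.mem_closure_image hTcl)
  have hall : ∀ t ∈ Icc 0 T,
      γ t ∈ rotated '' Metric.closedBall (0 : Matrix (Fin k) (Fin m) ℂ) c := by
    intro t ht
    rcases ht.2.eq_or_lt with rfl | h
    · exact hTK
    · exact image_mono Metric.ball_subset_closedBall (hbefore t ⟨ht.1, h⟩)
  -- At the exit time the point lies in the image of the closed ball but not of the open one.
  have hwT : ‖L (γ T)‖ = c := by
    obtain ⟨W, hW, hWT⟩ := hTK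
    rw [← hWT, hL W (hcb hW)]
    refine (mem_closedBall_zero_iff.1 hW).antisymm (not_lt.1 fun h => hTS.2 ?_)
    rw [← hWT]
    exact hmemO W (mem_ball_zero_iff.2 h)
  have hLdγ : ∀ t ∈ Icc 0 T, DifferentiableAt ℝ L (γ t) := by
    intro t ht
    obtain ⟨W, hW, hWt⟩ := hall t ht
    rw [← hWt]
    exact hLd W (hcb hW)
  have hmain := hγ.norm_lie_le_length (w := L ∘ γ) hT0.le hTS.1.2
    (fun t ht => ContinuousAt.comp_continuousWithinAt (hLdγ t ht).continuousAt
      ((hγc t ⟨ht.1, ht.2.trans hTS.1.2⟩).mono (Icc_subset_Icc_right hTS.1.2)))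
    (fun t ht => (hLdγ t (Ioo_subset_Icc_self ht)).comp t
      ((hγ.contDiffOn.differentiableOn one_ne_zero).differentiableAt
        (Icc_mem_nhds ht.1 (ht.2.trans_le hTS.1.2))))
    (by
      rw [Function.comp_apply, hγ.source, ← rotated_zero]
      exact hL 0 (Metric.mem_ball_self (hc0.trans hZr)))
    (fun t ht => by
      obtain ⟨W, hW, hWt⟩ := hall t ht
      rw [Function.comp_apply, ← hWt, hL W (hcb hW)])
  refine le_trans (le_of_eq ?_) hmain
  refine (sq_eq_sq₀ (norm_nonneg _) (norm_nonneg _)).1 ?_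
  rw [norm_lie_sq, norm_lie_sq, Function.comp_apply, hwT]

end Grassmann

end GeodesicLowerBound

/-! ### The chart and the distance formula together. -/

theorem mainTheorem3 (m n : ℕ) (hmn : m ≤ n) :
    ∃ r₀ : ℝ, 0 < r₀ ∧ ∀ r : ℝ, 0 < r → r ≤ r₀ →
      ∃ U : Set (Matrix (Fin m ⊕ Fin (n - m)) (Fin m ⊕ Fin (n - m)) ℂ),
        (∃ O : Set (Matrix (Fin m ⊕ Fin (n - m)) (Fin m ⊕ Fin (n - m)) ℂ),
          IsOpen O ∧ U = O ∩ Grassmann.Gr m (Fin m ⊕ Fin (n - m))) ∧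
        Grassmann.stdProj m (n - m) ∈ U ∧
        Set.BijOn Grassmann.rotated
          (Metric.ball (0 : Matrix (Fin (n - m)) (Fin m) ℂ) r) U ∧
        ∀ P ∈ U, ∀ Z ∈ Metric.ball (0 : Matrix (Fin (n - m)) (Fin m) ℂ) r,
          P = Grassmann.rotated Z →
            Grassmann.geodesicDist m (Grassmann.stdProj m (n - m)) P =
              ENNReal.ofReal ‖⁅Grassmann.blockZ Z, Grassmann.stdProj m (n - m)⁆‖ := by
  obtain ⟨r₀, hr₀, L, hL, hLd, hO⟩ := Grassmann.exists_log m (n - m)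
  refine ⟨r₀, hr₀, fun r hr hrr => ⟨Grassmann.rotated '' Metric.ball 0 r, hO r hrr,
    ⟨0, Metric.mem_ball_self hr, Grassmann.rotated_zero⟩, Set.InjOn.bijOn_image ?_, ?_⟩⟩
  · intro Z hZ W hW h
    rw [← hL Z (Metric.ball_subset_ball hrr hZ), h, hL W (Metric.ball_subset_ball hrr hW)]
  · rintro P - Z hZ rfl
    refine le_antisymm (Grassmann.geodesicDist_le Z) (le_iInf₂ fun γ hγ => ?_)
    exact ENNReal.ofReal_le_ofReal
      (Grassmann.norm_lie_le_length hL hLd hO (Metric.ball_subset_ball hrr hZ) hγ)
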